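/- **Corollary (most likely reductions in probabilistic PCF).** *Languages.* PCF is the simply typed $\lambda$-calculus over one ground type $\mathrm{Nat}$, with numerals $\underline n$, $\mathrm{succ}$, $\mathrm{pred}$ (with $\mathrm{pred}\,\underline 0\to\underline 0$), a conditional $\mathrm{ifz}(P,M,N)$ and a fixpoint operator $\mathbf Y M$. It is evaluated by call-by-name (weak head) reduction: the rules $(\lambda x.M)N\to M\{N/x\}$, $\mathbf YM\to M(\mathbf YM)$, $\mathrm{succ}\,\underline k\to\underline{k+1}$, $\mathrm{pred}\,\underline{k+1}\to\underline k$, $\mathrm{pred}\,\underline 0\to\underline 0$, $\mathrm{ifz}(\underline 0,M,N)\to M$, $\mathrm{ifz}(\underline{k+1},M,N)\to N$ are applied in the evaluation contexts $E::=[\,]\mid E\,N\mid\mathrm{succ}\,E\mid\mathrm{pred}\,E\mid\mathrm{ifz}(E,M,N)$. PPCF adds, at every type, binary probabilistic choices $M\oplus_{p}N$ with $M\oplus_pN\to M$ of probability $p$ and $M\oplus_pN\to N$ of probability $1-p$; all other steps have probability $1$. The biases are regarded as parameters: each choice carries a name $i$ from a set $I$ of parameters and has bias $p_i\in[0,1]$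 (a single parameter $p$ is the case where $I$ is a singleton). The probability $\mathbb P(\omega)$ of a reduction path $\omega$ is the product of the probabilities of its steps. *Tropical interpretation.* Let $\mathbb L=[0,\infty]$ with $\min$ (infinitary: $\inf$) as sum and $+$ as product. $\mathrm{PCF}^{\mathbb L}$ is PCF extended with $M+N$ and $\alpha\cdot M$ ($\alpha\in\mathbb L$). It is interpreted in the coKleisli category of the finite-multiset comonad $!$ on sets and $\mathbb L$-valued matrices: $[\![\mathrm{Nat}]\!]=\mathbb N$, $[\![A\to B]\!]={!}[\![A]\!]\times[\![B]\!]$, a context is interpreted by a disjoint union, and $\Gamma\vdash M:A$ by a matrix $[\![M]\!]\in\mathbb L^{![\![\Gamma]\!]\times[\![A]\!]}$. The $\lambda$-calculus is interpreted by the cartesian closed structure, $\mathbf Y$ by $\inf_k\mathrm{fix}_k$ with $\mathrm{fix}_0$ the zero (constantly $\infty$) matrix and $\mathrm{fix}_{k+1}=\mathsf{ev}\circ\langle\mathrm{id},\mathrm{fix}_k\rangle$, the arithmetic constants in the standard way, and $[\![\alpha\cdot M]\!]=[\![M]\!]+\alpha$, $[\![M+N]\!]=\min\{[\![M]\!],[\![N]\!]\}$.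 For closed $M:\mathrm{Nat}$ the matrix is a vector $([\![M]\!]_n)_{n\in\mathbb N}$. *Translation.* For costs $\alpha,\beta\in\mathbb L^I$, let $M\mapsto M^\circ(\alpha,\beta)$ be the translation of PPCF into $\mathrm{PCF}^{\mathbb L}$ that commutes with all constructors of PCF and sends a choice between $M$ and $N$ with parameter $i$ to $\alpha_i\cdot M^\circ+\beta_i\cdot N^\circ$. For closed $M:\mathrm{Nat}$ put $[\![M^\circ]\!]_n(\alpha,\beta):=[\![M^\circ(\alpha,\beta)]\!]_n$. *Statement.* Let $M$ be a closed PPCF term of type $\mathrm{Nat}$, $n\in\mathbb N$ and $p\in[0,1]^I$, and put $-\log 0=\infty$. Then $$[\![M^\circ]\!]_n\big((-\log p_i)_{i},(-\log(1-p_i))_{i}\big)=\inf\{-\log\mathbb P(\omega)\mid\omega:M\twoheadrightarrow\underline n\}$$ (where $\inf\emptyset=\infty$). If $M$ has some reduction path to $\underline n$, the infimum is a minimum: there is a most likely path, i.e. a path to $\underline n$ of maximal probability, and the left-hand side is the negative log-probability of any such path. -/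

import Mathlib

open scoped ENNReal

namespace TropicalPCF

universe u

/-! ### Types and variables -/

/-- Simple types over the single ground type of natural numbers. -/
inductive Ty : Type where
  | nat : Ty
  | arr : Ty → Ty → Ty

/-- A typing context (variables are de Bruijn indices). -/
abbrev Ctx : Type := List Ty

/-- `Var Γ A`: the variables of type `A` declared in `Γ`. -/
inductive Var : Ctx → Ty → Type where
  | zero {Γ : Ctx} {A : Ty} : Var (A :: Γ) A
  | succ {Γ : Ctx} {A B : Ty} : Var Γ A → Var (B :: Γ) A

/-! ### The language PCF over the tropical semiring -/

/-- Terms (i.e. typing derivations `Γ ⊢ M : A`) of PCF extended with the module operations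
`M + N` and `a · M`, for `a` in `[0, ∞]`. -/
inductive PCFL : Ctx → Ty → Type where
  | var {Γ : Ctx} {A : Ty} : Var Γ A → PCFL Γ A
  | lam {Γ : Ctx} {A B : Ty} : PCFL (A :: Γ) B → PCFL Γ (Ty.arr A B)
  | app {Γ : Ctx} {A B : Ty} : PCFL Γ (Ty.arr A B) → PCFL Γ A → PCFL Γ B
  | fix {Γ : Ctx} {A : Ty} : PCFL Γ (Ty.arr A A) → PCFL Γ A
  | num {Γ : Ctx} : ℕ → PCFL Γ Ty.nat
  | succ {Γ : Ctx} : PCFL Γ Ty.nat → PCFL Γ Ty.nat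
  | pred {Γ : Ctx} : PCFL Γ Ty.nat → PCFL Γ Ty.nat
  | ifz {Γ : Ctx} {A : Ty} : PCFL Γ Ty.nat → PCFL Γ A → PCFL Γ A → PCFL Γ A
  | plus {Γ : Ctx} {A : Ty} : PCFL Γ A → PCFL Γ A → PCFL Γ A
  | scale {Γ : Ctx} {A : Ty} : ℝ≥0∞ → PCFL Γ A → PCFL Γ A

/-! ### Matrices over the tropical semiring and the multiset comonad

The semiring is `[0, ∞]` with `min` (infinitary: `⨅`) as sum and `+` as product; its zero is `∞`
and its unit is `0`. -/

/-- The discrete tropical value of a proposition: the unit `0` if it holds, the zero `∞` if not. -/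
noncomputable def tval (P : Prop) : ℝ≥0∞ :=
  open Classical in if P then 0 else ∞

/-- Matrices indexed by `X × Y` with entries in `[0, ∞]`. -/
abbrev Mat (X Y : Type) : Type := X → Y → ℝ≥0∞

/-- Composition (product) of matrices. -/
noncomputable def Mat.comp {X Y Z : Type} (s : Mat Y Z) (t : Mat X Y) : Mat X Z :=
  fun a c => ⨅ b : Y, s b c + t a b

/-- The functor `!`, which sends a set to the set of its finite multisets: the entry of `!t` at
`([a₁, …, aₖ], [b₁, …, bₖ])` is the least of the sums of the `t aᵢ b_{σ i}` over all bijective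
pairings `σ`, and it is `∞` for multisets of different sizes. -/
noncomputable def Mat.bang {X Y : Type} (t : Mat X Y) : Mat (Multiset X) (Multiset Y) :=
  fun μ ν => ⨅ ρ : {ρ : Multiset (X × Y) // ρ.map Prod.fst = μ ∧ ρ.map Prod.snd = ν},
    (ρ.1.map fun q => t q.1 q.2).sum

/-- The comultiplication of the comonad `!`. -/
noncomputable def Mat.dig (X : Type) : Mat (Multiset X) (Multiset (Multiset X)) :=
  fun μ m => tval (m.sum = μ)

/-- Morphisms of the coKleisli category of `!`. -/
abbrev KMat (X Y : Type) : Type := Mat (Multiset X) Y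

namespace KMat

/-- Identity of the coKleisli category, which is the counit of `!`. -/
noncomputable def id (X : Type) : KMat X X := fun μ a => tval (μ = {a})

/-- Composition of the coKleisli category. -/
noncomputable def comp {X Y Z : Type} (s : KMat Y Z) (t : KMat X Y) : KMat X Z :=
  Mat.comp s (Mat.comp (Mat.bang t) (Mat.dig X))

/-- First projection; the cartesian product of `X` and `Y` is their disjoint union. -/
noncomputable def fst (X Y : Type) : KMat (X ⊕ Y) X := fun μ a => tval (μ = {Sum.inl a})

/-- Second projection. -/
noncomputable def snd (X Y : Type) : KMat (X ⊕ Y) Y := fun μ b => tval (μ = {Sum.inr b})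

/-- Pairing. -/
def pair {X Y Z : Type} (s : KMat Z X) (t : KMat Z Y) : KMat Z (X ⊕ Y) :=
  fun μ => Sum.elim (s μ) (t μ)

/-- Evaluation; the exponential object of `X` and `Y` is `!X × Y`. -/
noncomputable def ev (X Y : Type) : KMat ((Multiset X × Y) ⊕ X) Y :=
  fun μ b => tval (∃ ν : Multiset X, μ = {Sum.inl (ν, b)} + ν.map Sum.inr)

/-- Currying (of the first variable). -/
def curry {X Y Z : Type} (t : KMat (X ⊕ Z) Y) : KMat Z (Multiset X × Y) :=
  fun μ q => t (q.1.map Sum.inl + μ.map Sum.inr) q.2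

/-- The finite approximations of the fixpoint morphism: the zero morphism, then `f ↦ f (fixₙ f)`. -/
noncomputable def fixApprox (X : Type) : ℕ → KMat (Multiset X × X) X
  | 0 => fun _ _ => ∞
  | k + 1 => comp (ev X X) (pair (id (Multiset X × X)) (fixApprox X k))

/-- The fixpoint morphism. -/
noncomputable def fix (X : Type) : KMat (Multiset X × X) X :=
  fun μ a => ⨅ k : ℕ, fixApprox X k μ a

/-- The constant morphism with value the number `k`. -/
noncomputable def num (X : Type) (k : ℕ) : KMat X ℕ := fun μ m => tval (μ = 0 ∧ m = k)

/-- The successor morphism. -/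
noncomputable def succ : KMat ℕ ℕ := fun μ m => tval (∃ k : ℕ, μ = {k} ∧ m = k + 1)

/-- The predecessor morphism; the predecessor of `0` is `0`. -/
noncomputable def pred : KMat ℕ ℕ := fun μ m => tval (∃ k : ℕ, μ = {k} ∧ m = k - 1)

/-- The conditional: the second argument if the first one is `0`, otherwise the third one. -/
noncomputable def cond (X : Type) : KMat (ℕ ⊕ (X ⊕ X)) X :=
  fun μ a => tval (μ = {Sum.inl 0, Sum.inr (Sum.inl a)} ∨
    ∃ k : ℕ, μ = {Sum.inl (k + 1), Sum.inr (Sum.inr a)})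

end KMat

/-! ### The tropical relational interpretation -/

/-- The set interpreting a type. -/
@[reducible]
def Ty.web : Ty → Type
  | .nat => ℕ
  | .arr A B => Multiset A.web × B.web

/-- The set interpreting a context: the disjoint union of the sets interpreting its types. -/
@[reducible]
def ctxWeb : Ctx → Type
  | [] => Empty
  | A :: Γ => A.web ⊕ ctxWeb Γ

/-- Variables are interpreted as projections. -/
noncomputable def Var.interp {A : Ty} : {Γ : Ctx} → Var Γ A → KMat (ctxWeb Γ) A.web
  | B :: Γ, .zero => KMat.fst B.web (ctxWeb Γ)
  | B :: Γ, .succ x => KMat.comp x.interp (KMat.snd B.web (ctxWeb Γ))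

/-- The interpretation of `Γ ⊢ M : A` as a coKleisli morphism. -/
noncomputable def PCFL.interp : {Γ : Ctx} → {A : Ty} → PCFL Γ A → KMat (ctxWeb Γ) A.web
  | _, _, .var x => x.interp
  | _, _, .lam M => KMat.curry M.interp
  | _, _, .app M N => KMat.comp (KMat.ev _ _) (KMat.pair M.interp N.interp)
  | _, A, .fix M => KMat.comp (KMat.fix A.web) M.interp
  | Γ, _, .num k => KMat.num (ctxWeb Γ) k
  | _, _, .succ M => KMat.comp KMat.succ M.interp
  | _, _, .pred M => KMat.comp KMat.pred M.interp
  | _, A, .ifz P M N =>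
      KMat.comp (KMat.cond A.web) (KMat.pair P.interp (KMat.pair M.interp N.interp))
  | _, _, .plus M N => fun μ a => min (M.interp μ a) (N.interp μ a)
  | _, _, .scale c M => fun μ a => M.interp μ a + c

/-- The `n`-th component of the interpretation of a closed term of ground type. -/
noncomputable def PCFL.component (M : PCFL [] Ty.nat) (n : ℕ) : ℝ≥0∞ :=
  M.interp (0 : Multiset Empty) n

/-! ### Probabilistic PCF -/

/-- Terms (i.e. typing derivations `Γ ⊢ M : A`) of PCF extended with probabilistic choice.
`choice i M N` is a coin toss whose bias is the probability parameter named `i`. -/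
inductive PPCF (ι : Type u) : Ctx → Ty → Type u where
  | var {Γ : Ctx} {A : Ty} : Var Γ A → PPCF ι Γ A
  | lam {Γ : Ctx} {A B : Ty} : PPCF ι (A :: Γ) B → PPCF ι Γ (Ty.arr A B)
  | app {Γ : Ctx} {A B : Ty} : PPCF ι Γ (Ty.arr A B) → PPCF ι Γ A → PPCF ι Γ B
  | fix {Γ : Ctx} {A : Ty} : PPCF ι Γ (Ty.arr A A) → PPCF ι Γ A
  | num {Γ : Ctx} : ℕ → PPCF ι Γ Ty.nat
  | succ {Γ : Ctx} : PPCF ι Γ Ty.nat → PPCF ι Γ Ty.nat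
  | pred {Γ : Ctx} : PPCF ι Γ Ty.nat → PPCF ι Γ Ty.nat
  | ifz {Γ : Ctx} {A : Ty} : PPCF ι Γ Ty.nat → PPCF ι Γ A → PPCF ι Γ A → PPCF ι Γ A
  | choice {Γ : Ctx} {A : Ty} : ι → PPCF ι Γ A → PPCF ι Γ A → PPCF ι Γ A

namespace PPCF

variable {ι : Type u}

/-- Extension of a renaming under a binder. -/
def liftRen {Γ Δ : Ctx} (r : ∀ A : Ty, Var Γ A → Var Δ A) (B : Ty) :
    ∀ A : Ty, Var (B :: Γ) A → Var (B :: Δ) A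
  | _, .zero => .zero
  | A, .succ x => .succ (r A x)

/-- Renaming of variables. -/
def rename : {Γ Δ : Ctx} → {A : Ty} → (∀ B : Ty, Var Γ B → Var Δ B) → PPCF ι Γ A → PPCF ι Δ A
  | _, _, _, r, .var x => .var (r _ x)
  | _, _, _, r, .lam M => .lam (rename (liftRen r _) M)
  | _, _, _, r, .app M N => .app (rename r M) (rename r N)
  | _, _, _, r, .fix M => .fix (rename r M)
  | _, _, _, _, .num k => .num k
  | _, _, _, r, .succ M => .succ (rename r M)
  | _, _, _, r, .pred M => .pred (rename r M)
  | _, _, _, r, .ifz P M N => .ifz (rename r P) (rename r M) (rename r N)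
  | _, _, _, r, .choice i M N => .choice i (rename r M) (rename r N)

/-- Extension of a simultaneous substitution under a binder. -/
def liftSubst {Γ Δ : Ctx} (s : ∀ A : Ty, Var Γ A → PPCF ι Δ A) (B : Ty) :
    ∀ A : Ty, Var (B :: Γ) A → PPCF ι (B :: Δ) A
  | _, .zero => .var .zero
  | A, .succ x => rename (fun _ y => Var.succ y) (s A x)

/-- Simultaneous (capture-avoiding) substitution. -/
def subst : {Γ Δ : Ctx} → {A : Ty} → (∀ B : Ty, Var Γ B → PPCF ι Δ B) → PPCF ι Γ A → PPCF ι Δ A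
  | _, _, _, s, .var x => s _ x
  | _, _, _, s, .lam M => .lam (subst (liftSubst s _) M)
  | _, _, _, s, .app M N => .app (subst s M) (subst s N)
  | _, _, _, s, .fix M => .fix (subst s M)
  | _, _, _, _, .num k => .num k
  | _, _, _, s, .succ M => .succ (subst s M)
  | _, _, _, s, .pred M => .pred (subst s M)
  | _, _, _, s, .ifz P M N => .ifz (subst s P) (subst s M) (subst s N)
  | _, _, _, s, .choice i M N => .choice i (subst s M) (subst s N)

/-- The substitution that replaces the last declared variable by `N`. -/
def single {Γ : Ctx} {B : Ty} (N : PPCF ι Γ B) : ∀ A : Ty, Var (B :: Γ) A → PPCF ι Γ A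
  | _, .zero => N
  | _, .succ x => .var x

/-- `M.inst N` is `M{N/x}`, where `x` is the last declared variable of `M`. -/
def inst {Γ : Ctx} {A B : Ty} (M : PPCF ι (B :: Γ) A) (N : PPCF ι Γ B) : PPCF ι Γ A :=
  subst (single N) M

/-- One-step call-by-name (weak head) reduction. Reduction takes place only at the root, in
function position, under `succ` and `pred`, and in the test of a conditional. -/
inductive Step : {Γ : Ctx} → {A : Ty} → PPCF ι Γ A → PPCF ι Γ A → Type u where
  | beta {Γ : Ctx} {A B : Ty} (M : PPCF ι (A :: Γ) B) (N : PPCF ι Γ A) :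
      Step (.app (.lam M) N) (M.inst N)
  | unfold {Γ : Ctx} {A : Ty} (M : PPCF ι Γ (Ty.arr A A)) : Step (.fix M) (.app M (.fix M))
  | succNum {Γ : Ctx} (k : ℕ) : Step (.succ (.num (Γ := Γ) k)) (.num (k + 1))
  | predZero {Γ : Ctx} : Step (.pred (.num (Γ := Γ) 0)) (.num 0)
  | predSucc {Γ : Ctx} (k : ℕ) : Step (.pred (.num (Γ := Γ) (k + 1))) (.num k)
  | ifzZero {Γ : Ctx} {A : Ty} (M N : PPCF ι Γ A) : Step (.ifz (.num 0) M N) M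
  | ifzSucc {Γ : Ctx} {A : Ty} (k : ℕ) (M N : PPCF ι Γ A) : Step (.ifz (.num (k + 1)) M N) N
  | choiceLeft {Γ : Ctx} {A : Ty} (i : ι) (M N : PPCF ι Γ A) : Step (.choice i M N) M
  | choiceRight {Γ : Ctx} {A : Ty} (i : ι) (M N : PPCF ι Γ A) : Step (.choice i M N) N
  | appCtx {Γ : Ctx} {A B : Ty} {M M' : PPCF ι Γ (Ty.arr A B)} (N : PPCF ι Γ A) :
      Step M M' → Step (.app M N) (.app M' N)
  | succCtx {Γ : Ctx} {M M' : PPCF ι Γ Ty.nat} : Step M M' → Step (.succ M) (.succ M')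
  | predCtx {Γ : Ctx} {M M' : PPCF ι Γ Ty.nat} : Step M M' → Step (.pred M) (.pred M')
  | ifzCtx {Γ : Ctx} {A : Ty} {P P' : PPCF ι Γ Ty.nat} (M N : PPCF ι Γ A) :
      Step P P' → Step (.ifz P M N) (.ifz P' M N)

/-- The probability of a reduction step, given the values `p i` of the parameters. -/
noncomputable def Step.prob (p : ι → unitInterval) :
    {Γ : Ctx} → {A : Ty} → {M N : PPCF ι Γ A} → Step M N → unitInterval
  | _, _, _, _, .choiceLeft i _ _ => p i
  | _, _, _, _, .choiceRight i _ _ => unitInterval.symm (p i)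
  | _, _, _, _, .appCtx _ h => h.prob p
  | _, _, _, _, .succCtx h => h.prob p
  | _, _, _, _, .predCtx h => h.prob p
  | _, _, _, _, .ifzCtx _ _ h => h.prob p
  | _, _, _, _, .beta _ _ => 1
  | _, _, _, _, .unfold _ => 1
  | _, _, _, _, .succNum _ => 1
  | _, _, _, _, .predZero => 1
  | _, _, _, _, .predSucc _ => 1
  | _, _, _, _, .ifzZero _ _ => 1
  | _, _, _, _, .ifzSucc _ _ _ => 1

/-- Reduction paths, i.e. finite sequences of consecutive reduction steps. -/
inductive Path {Γ : Ctx} {A : Ty} : PPCF ι Γ A → PPCF ι Γ A → Type u where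
  | nil (M : PPCF ι Γ A) : Path M M
  | cons {M M' N : PPCF ι Γ A} : Step M M' → Path M' N → Path M N

/-- The probability of a path: the product of the probabilities of its steps. -/
noncomputable def Path.prob (p : ι → unitInterval) {Γ : Ctx} {A : Ty} :
    {M N : PPCF ι Γ A} → Path M N → unitInterval
  | _, _, .nil _ => 1
  | _, _, .cons h ω => h.prob p * ω.prob p

/-- `ω` is a most likely path among the paths with the same source and target. -/
def Path.IsMostLikely (p : ι → unitInterval) {Γ : Ctx} {A : Ty} {M N : PPCF ι Γ A}
    (ω : Path M N) : Prop :=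
  ∀ ω' : Path M N, ω'.prob p ≤ ω.prob p

/-- The translation into PCF over the tropical semiring, as a function of the costs `a i` and `b i`
of the left and of the right outcome of the coin named `i`. -/
def translate (a b : ι → ℝ≥0∞) : {Γ : Ctx} → {A : Ty} → PPCF ι Γ A → PCFL Γ A
  | _, _, .var x => .var x
  | _, _, .lam M => .lam (translate a b M)
  | _, _, .app M N => .app (translate a b M) (translate a b N)
  | _, _, .fix M => .fix (translate a b M)
  | _, _, .num k => .num k
  | _, _, .succ M => .succ (translate a b M)
  | _, _, .pred M => .pred (translate a b M)
  | _, _, .ifz P M N => .ifz (translate a b P) (translate a b M) (translate a b N)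
  | _, _, .choice i M N =>
      .plus (.scale (a i) (translate a b M)) (.scale (b i) (translate a b N))

end PPCF

/-- The negative logarithm of a probability, with `-log 0 = ∞`. -/
noncomputable def negLog (x : unitInterval) : ℝ≥0∞ :=
  if (x : ℝ) = 0 then ∞ else ENNReal.ofReal (-Real.log (x : ℝ))

end TropicalPCF

open TropicalPCF

/-! The tropical matrix records only infima, from which no reduction path can be read off. It is
therefore refined to the interpretation `PPCF.weights`, with coefficients in sets of pairs (cost,
number of steps). Taking the least cost turns unions into infima and elementwise sums into sums, so
it commutes with all the constructions involved, and `PPCF.least_weights` recovers the tropical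
interpretation.

Steps are charged so that every weak head step is paid for exactly once: 1 for an application, an
arithmetic operation, a conditional or a choice, and 2 for unfolding a fixpoint together with the
application thus created. The multiset semantics pays for an argument once per use, just as
call-by-name evaluates it once per use, so the accounting is exact. Given the substitution lemma
`weights_subst`, a step adds its negative log-probability and 1 to a weight of its target
(`Step.weights_of_weights`); conversely, every weight of a closed non-value comes in this way from
some step (`isValue_or_exists_step`). Hence the costs of `M` at `n` are exactly the negative
log-probabilities of the paths from `M` to `n`. Extracting a path from a weight is an induction on
the step count, so no reducibility argument is needed in spite of the fixpoints.

For attainment, `M` contains finitely many coins, so every cost is a finite sum of elements of one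
finite set. By Higman's lemma such sums form a well-ordered subset of `[0, ∞]`. A least cost
therefore exists, and it belongs to a path of greatest probability because `negLog` reverses the
order. -/

namespace TropicalPCF

universe u

/-! ### Matrices with coefficients in sets of weights

A weight is a pair of a cost and a number of steps. Sets of weights, with union as sum and the
elementwise addition as product, form a complete semiring, and the least cost is a morphism to the
tropical semiring. -/

/-- Pairs of a cost and a number of reduction steps. -/
abbrev Weight : Type := ℝ≥0∞ × ℕ

/-- The coKleisli morphisms with coefficients in the sets of weights. -/
abbrev KRel (X Y : Type) : Type := Multiset X → Y → Weight → Prop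

namespace KRel

variable {W X Y Z : Type}

/-- The action of the functor `!` after the comultiplication. -/
inductive Bunch (T : KRel X Y) : Multiset X → Multiset Y → Weight → Prop
  | zero : Bunch T 0 0 0
  | cons {μ σ : Multiset X} {a : Y} {ν : Multiset Y} {k l : Weight} :
      T μ a k → Bunch T σ ν l → Bunch T (μ + σ) (a ::ₘ ν) (k + l)

/-- Composition of the coKleisli category. -/
def comp (S : KRel Y Z) (T : KRel X Y) : KRel X Z :=
  fun μ c k => ∃ ν k₁ k₂, Bunch T μ ν k₁ ∧ S ν c k₂ ∧ k = k₁ + k₂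

/-- The linear morphism induced by a function. -/
def ofFun (f : Y → X) : KRel X Y := fun μ a k => μ = {f a} ∧ k = 0

/-- Pairing. -/
def pair (S : KRel Z X) (T : KRel Z Y) : KRel Z (X ⊕ Y) := fun μ => Sum.elim (S μ) (T μ)

/-- Evaluation, taking `w` steps. -/
def ev (X Y : Type) (w : ℕ) : KRel ((Multiset X × Y) ⊕ X) Y :=
  fun μ b k => ∃ ν : Multiset X, μ = {Sum.inl (ν, b)} + ν.map Sum.inr ∧ k = (0, w)

/-- Currying. -/
def curry (T : KRel (X ⊕ Z) Y) : KRel Z (Multiset X × Y) :=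
  fun μ q => T (q.1.map Sum.inl + μ.map Sum.inr) q.2

/-- The finite approximations of the fixpoint morphism, where each unfolding takes two steps. -/
def fixApprox (X : Type) : ℕ → KRel (Multiset X × X) X
  | 0 => fun _ _ _ => False
  | n + 1 => comp (ev X X 2) (pair (ofFun _root_.id) (fixApprox X n))

/-- The fixpoint morphism. -/
def fix (X : Type) : KRel (Multiset X × X) X := fun μ a k => ∃ n, fixApprox X n μ a k

/-- The constant morphism with value a number. -/
def num (X : Type) (j : ℕ) : KRel X ℕ := fun μ m k => (μ = 0 ∧ m = j) ∧ k = 0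

/-- The morphism induced by an operation on numbers, in one step. -/
def op (f : ℕ → ℕ) : KRel ℕ ℕ := fun μ m k => (∃ j : ℕ, μ = {j} ∧ m = f j) ∧ k = (0, 1)

/-- The conditional, in one step. -/
def cond (X : Type) : KRel (ℕ ⊕ (X ⊕ X)) X :=
  fun μ a k => (μ = {Sum.inl 0, Sum.inr (Sum.inl a)} ∨
    ∃ j : ℕ, μ = {Sum.inl (j + 1), Sum.inr (Sum.inr a)}) ∧ k = (0, 1)

/-! ### Decomposition of bunches -/

theorem bunch_zero_iff {T : KRel X Y} {σ : Multiset X} {k : Weight} :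
    Bunch T σ 0 k ↔ σ = 0 ∧ k = 0 := by
  constructor
  · intro h
    generalize hν : (0 : Multiset Y) = ν at h
    cases h with
    | zero => exact ⟨rfl, rfl⟩
    | cons _ _ => exact absurd hν (Multiset.zero_ne_cons)
  · rintro ⟨rfl, rfl⟩
    exact .zero

/-- A derivation lists the output multiset in some order; since sums of inputs and of weights
commute, any chosen element can be moved to the front. -/
theorem bunch_cons_iff {T : KRel X Y} {σ : Multiset X} {a : Y} {ν : Multiset Y} {k : Weight} :
    Bunch T σ (a ::ₘ ν) k ↔
      ∃ μ σ' k₁ k₂, T μ a k₁ ∧ Bunch T σ' ν k₂ ∧ σ = μ + σ' ∧ k = k₁ + k₂ := by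
  constructor
  · intro h
    generalize hθ : a ::ₘ ν = θ at h
    induction h generalizing ν with
    | zero => exact absurd hθ.symm (Multiset.zero_ne_cons)
    | @cons μ σ b θ k l hT hB ih =>
      rcases Multiset.cons_eq_cons.1 hθ with ⟨rfl, rfl⟩ | ⟨_, τ, rfl, rfl⟩
      · exact ⟨_, _, _, _, hT, hB, rfl, rfl⟩
      · obtain ⟨μ', σ', k₁, k₂, h₁, h₂, rfl, rfl⟩ := ih rfl
        exact ⟨μ', μ + σ', k₁, k + k₂, h₁, .cons hT h₂, by abel, by abel⟩
  · rintro ⟨μ, σ', k₁, k₂, h₁, h₂, rfl, rfl⟩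
    exact .cons h₁ h₂

theorem bunch_singleton_iff {T : KRel X Y} {σ : Multiset X} {a : Y} {k : Weight} :
    Bunch T σ {a} k ↔ T σ a k := by
  rw [← Multiset.cons_zero, bunch_cons_iff]
  constructor
  · rintro ⟨μ, σ', k₁, k₂, h₁, h₂, rfl, rfl⟩
    obtain ⟨rfl, rfl⟩ := bunch_zero_iff.1 h₂
    simpa using h₁
  · intro h
    exact ⟨σ, 0, k, 0, h, .zero, by simp, by simp⟩

theorem bunch_add_iff {T : KRel X Y} {σ : Multiset X} {ν θ : Multiset Y} {k : Weight} :
    Bunch T σ (ν + θ) k ↔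
      ∃ σ₁ σ₂ k₁ k₂, Bunch T σ₁ ν k₁ ∧ Bunch T σ₂ θ k₂ ∧ σ = σ₁ + σ₂ ∧ k = k₁ + k₂ := by
  constructor
  · intro h
    induction ν using Multiset.induction_on generalizing σ k with
    | empty => exact ⟨0, σ, 0, k, .zero, by simpa using h, by simp, by simp⟩
    | cons a ν ih =>
      rw [Multiset.cons_add, bunch_cons_iff] at h
      obtain ⟨μ, σ', k₁, k₂, h₁, h₂, rfl, rfl⟩ := h
      obtain ⟨σ₁, σ₂, l₁, l₂, h₃, h₄, rfl, rfl⟩ := ih h₂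
      exact ⟨μ + σ₁, σ₂, k₁ + l₁, l₂, .cons h₁ h₃, h₄, by abel, by abel⟩
  · rintro ⟨σ₁, σ₂, k₁, k₂, h₁, h₂, rfl, rfl⟩
    induction h₁ with
    | zero => simpa using h₂
    | cons hT _ ih =>
      rw [Multiset.cons_add, add_assoc, add_assoc]
      exact .cons hT ih

theorem bunch_pair_iff {T : KRel X Y} {σ : Multiset X} {a b : Y} {k : Weight} :
    Bunch T σ {a, b} k ↔
      ∃ σ₁ σ₂ k₁ k₂, T σ₁ a k₁ ∧ T σ₂ b k₂ ∧ σ = σ₁ + σ₂ ∧ k = k₁ + k₂ := by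
  simp only [Multiset.insert_eq_cons, bunch_cons_iff, bunch_singleton_iff]

theorem Bunch.mono {S T : KRel X Y} (h : ∀ μ a k, S μ a k → T μ a k) {σ : Multiset X}
    {ν : Multiset Y} {k : Weight} (hB : Bunch S σ ν k) : Bunch T σ ν k := by
  induction hB with
  | zero => exact .zero
  | cons hS _ ih => exact .cons (h _ _ _ hS) ih

theorem bunch_map_iff {T : KRel X Y} {f : Z → Y} {σ : Multiset X} {ν : Multiset Z} {k : Weight} :
    Bunch T σ (ν.map f) k ↔ Bunch (fun μ c => T μ (f c)) σ ν k := by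
  induction ν using Multiset.induction_on generalizing σ k with
  | empty => simp [bunch_zero_iff]
  | cons a ν ih => simp only [Multiset.map_cons, bunch_cons_iff, ih]

theorem bunch_pair_map_inl_iff {S : KRel Z X} {T : KRel Z Y} {σ : Multiset Z} {ν : Multiset X}
    {k : Weight} : Bunch (pair S T) σ (ν.map Sum.inl) k ↔ Bunch S σ ν k :=
  bunch_map_iff

theorem bunch_pair_map_inr_iff {S : KRel Z X} {T : KRel Z Y} {σ : Multiset Z} {ν : Multiset Y}
    {k : Weight} : Bunch (pair S T) σ (ν.map Sum.inr) k ↔ Bunch T σ ν k :=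
  bunch_map_iff

theorem bunch_ofFun_iff {f : Y → X} {σ : Multiset X} {ν : Multiset Y} {k : Weight} :
    Bunch (ofFun f) σ ν k ↔ σ = ν.map f ∧ k = 0 := by
  induction ν using Multiset.induction_on generalizing σ k with
  | empty => simp [bunch_zero_iff]
  | cons a ν ih =>
    simp only [bunch_cons_iff, ih, ofFun, Multiset.map_cons]
    constructor
    · rintro ⟨_, _, _, _, ⟨rfl, rfl⟩, ⟨rfl, rfl⟩, rfl, rfl⟩
      simp
    · rintro ⟨rfl, rfl⟩
      exact ⟨_, _, _, _, ⟨rfl, rfl⟩, ⟨rfl, rfl⟩, by simp, by simp⟩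

/-! ### Categorical laws -/

/-- Lifting to multisets respects composition; associativity of `comp` is a consequence. -/
theorem bunch_comp_iff {S : KRel Y Z} {T : KRel X Y} {σ : Multiset X} {ν : Multiset Z}
    {k : Weight} : Bunch (comp S T) σ ν k ↔
      ∃ θ k₁ k₂, Bunch T σ θ k₁ ∧ Bunch S θ ν k₂ ∧ k = k₁ + k₂ := by
  constructor
  · intro h
    induction h with
    | zero => exact ⟨0, 0, 0, .zero, .zero, by simp⟩
    | cons hT _ ih =>
      obtain ⟨θ, l₁, l₂, h₁, h₂, rfl⟩ := hT
      obtain ⟨θ', l₁', l₂', h₁', h₂', rfl⟩ := ih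
      exact ⟨θ + θ', l₁ + l₁', l₂ + l₂', bunch_add_iff.2 ⟨_, _, _, _, h₁, h₁', rfl, rfl⟩,
        .cons h₂ h₂', by abel⟩
  · rintro ⟨θ, k₁, k₂, h₁, h₂, rfl⟩
    induction h₂ generalizing σ k₁ with
    | zero =>
      obtain ⟨rfl, rfl⟩ := bunch_zero_iff.1 h₁
      simpa using Bunch.zero
    | cons hS _ ih =>
      obtain ⟨σ₁, σ₂, l₁, l₂, h₃, h₄, rfl, rfl⟩ := bunch_add_iff.1 h₁
      rw [add_add_add_comm]
      exact .cons ⟨_, _, _, h₃, hS, rfl⟩ (ih _ h₄)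

theorem comp_assoc (R : KRel Y Z) (S : KRel X Y) (T : KRel W X) :
    comp (comp R S) T = comp R (comp S T) := by
  funext μ c k
  simp only [comp, bunch_comp_iff, eq_iff_iff]
  constructor
  · rintro ⟨ν, k₁, _, h₁, ⟨θ, l₁, l₂, h₂, h₃, rfl⟩, rfl⟩
    exact ⟨θ, _, _, ⟨ν, _, _, h₁, h₂, rfl⟩, h₃, by abel⟩
  · rintro ⟨θ, _, l₂, ⟨ν, k₁, l₁, h₁, h₂, rfl⟩, h₃, rfl⟩
    exact ⟨ν, _, _, h₁, ⟨θ, _, _, h₂, h₃, rfl⟩, by abel⟩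

theorem comp_ofFun_iff {S : KRel Y Z} {f : Y → X} {μ : Multiset X} {c : Z} {k : Weight} :
    comp S (ofFun f) μ c k ↔ ∃ ν, μ = ν.map f ∧ S ν c k := by
  simp only [comp, bunch_ofFun_iff]
  constructor
  · rintro ⟨ν, _, _, ⟨rfl, rfl⟩, h, rfl⟩
    exact ⟨ν, rfl, by simpa using h⟩
  · rintro ⟨ν, rfl, h⟩
    exact ⟨ν, 0, k, ⟨rfl, rfl⟩, h, by simp⟩

theorem ofFun_comp (f : Z → Y) (T : KRel X Y) : comp (ofFun f) T = fun μ c => T μ (f c) := by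
  funext μ c k
  simp only [comp, ofFun, eq_iff_iff]
  constructor
  · rintro ⟨_, _, _, h, ⟨rfl, rfl⟩, rfl⟩
    simpa [bunch_singleton_iff] using h
  · intro h
    exact ⟨_, k, 0, bunch_singleton_iff.2 h, ⟨rfl, rfl⟩, by simp⟩

theorem pair_comp (R : KRel X Y) (S : KRel X Z) (T : KRel W X) :
    comp (pair R S) T = pair (comp R T) (comp S T) := by
  funext μ c k
  cases c <;> rfl

theorem inl_comp_pair (S : KRel Z X) (T : KRel Z Y) : comp (ofFun Sum.inl) (pair S T) = S :=
  ofFun_comp _ _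

theorem inr_comp_pair (S : KRel Z X) (T : KRel Z Y) : comp (ofFun Sum.inr) (pair S T) = T :=
  ofFun_comp _ _

theorem pair_inl_inr : pair (ofFun (Sum.inl : X → X ⊕ Y)) (ofFun Sum.inr) = ofFun _root_.id := by
  funext μ c k
  cases c <;> rfl

theorem num_comp (T : KRel X Y) (j : ℕ) : comp (num Y j) T = num X j := by
  funext μ m k
  simp only [comp, num, eq_iff_iff]
  constructor
  · rintro ⟨_, _, _, h, ⟨⟨rfl, rfl⟩, rfl⟩, rfl⟩
    obtain ⟨rfl, rfl⟩ := bunch_zero_iff.1 h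
    simp
  · rintro ⟨⟨rfl, rfl⟩, rfl⟩
    exact ⟨0, 0, 0, .zero, by simp, by simp⟩

/-- Each component is recovered by filtering the elements of one side. -/
theorem map_inl_add_map_inr_inj {ν ν' : Multiset X} {θ θ' : Multiset Y}
    (h : ν.map Sum.inl + θ.map Sum.inr = ν'.map Sum.inl + θ'.map Sum.inr) : ν = ν' ∧ θ = θ' := by
  have h₁ := congrArg (Multiset.filterMap Sum.getLeft?) h
  have h₂ := congrArg (Multiset.filterMap Sum.getRight?) h
  simp only [Multiset.filterMap_add, Multiset.filterMap_map] at h₁ h₂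
  have e₁ : (Sum.getLeft? ∘ (Sum.inl : X → X ⊕ Y)) = some := rfl
  have e₂ : (Sum.getLeft? ∘ (Sum.inr : Y → X ⊕ Y)) = fun _ => none := rfl
  have e₃ : (Sum.getRight? ∘ (Sum.inl : X → X ⊕ Y)) = fun _ => none := rfl
  have e₄ : (Sum.getRight? ∘ (Sum.inr : Y → X ⊕ Y)) = some := rfl
  have n₁ (s : Multiset Y) : s.filterMap (fun _ => (none : Option X)) = 0 := by
    induction s using Multiset.induction_on <;> simp [*]
  have n₂ (s : Multiset X) : s.filterMap (fun _ => (none : Option Y)) = 0 := by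
    induction s using Multiset.induction_on <;> simp [*]
  rw [e₁, e₂, n₁, n₁] at h₁
  rw [e₃, e₄, n₂, n₂] at h₂
  rw [zero_add, zero_add] at h₂
  rw [add_zero, add_zero] at h₁
  simpa only [Multiset.filterMap_some] using And.intro h₁ h₂

/-- This is the action of a substitution under a binder: the bound part passes through unchanged and
free of charge, the rest goes through `T`. -/
theorem bunch_lift_iff {T : KRel X Y} {ν : Multiset W} {μ : Multiset X} {θ : Multiset (W ⊕ Y)}
    {k : Weight} :
    Bunch (pair (ofFun Sum.inl) (comp T (ofFun Sum.inr))) (ν.map Sum.inl + μ.map Sum.inr) θ k ↔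
      ∃ τ, θ = ν.map Sum.inl + τ.map Sum.inr ∧ Bunch T μ τ k := by
  constructor
  · intro h
    generalize hσ : ν.map Sum.inl + μ.map Sum.inr = σ at h
    -- The induction needs an arbitrary input, so some splitting is produced first; it is the given
    -- one because splittings are unique.
    have : ∃ (ν' : Multiset W) (μ' : Multiset X) (τ : Multiset Y),
        σ = ν'.map Sum.inl + μ'.map Sum.inr ∧
        θ = ν'.map Sum.inl + τ.map Sum.inr ∧ Bunch T μ' τ k := by
      clear hσ
      induction h with
      | zero => exact ⟨0, 0, 0, by simp, by simp, .zero⟩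
      | @cons _ _ a _ _ _ hT _ ih =>
        obtain ⟨ν', μ', τ, rfl, rfl, hB⟩ := ih
        cases a with
        | inl a =>
          obtain ⟨rfl, rfl⟩ := hT
          exact ⟨a ::ₘ ν', μ', τ, by simp, by simp, by simpa using hB⟩
        | inr b =>
          obtain ⟨μ₁, rfl, hT'⟩ := comp_ofFun_iff.1 hT
          exact ⟨ν', μ₁ + μ', b ::ₘ τ, by simp only [Multiset.map_add]; abel, by simp,
            .cons hT' hB⟩
    obtain ⟨ν', μ', τ, rfl, rfl, hB⟩ := this
    obtain ⟨rfl, rfl⟩ := map_inl_add_map_inr_inj hσ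
    exact ⟨τ, rfl, hB⟩
  · rintro ⟨τ, rfl, h⟩
    refine bunch_add_iff.2 ⟨_, _, 0, k, bunch_pair_map_inl_iff.2 (bunch_ofFun_iff.2 ⟨rfl, rfl⟩),
      bunch_pair_map_inr_iff.2 (bunch_comp_iff.2 ?_), rfl, by simp⟩
    exact ⟨μ, 0, k, bunch_ofFun_iff.2 ⟨rfl, rfl⟩, h, by simp⟩

theorem curry_comp (R : KRel (W ⊕ Y) Z) (T : KRel X Y) :
    comp (curry R) T = curry (comp R (pair (ofFun Sum.inl) (comp T (ofFun Sum.inr)))) := by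
  funext μ q k
  simp only [comp, curry, bunch_lift_iff, eq_iff_iff]
  constructor
  · rintro ⟨τ, k₁, k₂, h₁, h₂, rfl⟩
    exact ⟨_, k₁, k₂, ⟨τ, rfl, h₁⟩, h₂, rfl⟩
  · rintro ⟨_, k₁, k₂, ⟨τ, rfl, h₁⟩, h₂, rfl⟩
    exact ⟨τ, k₁, k₂, h₁, h₂, rfl⟩

/-! ### Explicit weights of applications, operations and conditionals -/

theorem comp_ev_pair_iff {R : KRel Z (Multiset X × Y)} {S : KRel Z X} {w : ℕ} {μ : Multiset Z}
    {b : Y} {k : Weight} : comp (ev X Y w) (pair R S) μ b k ↔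
      ∃ ν μ₁ μ₂ k₁ k₂, R μ₁ (ν, b) k₁ ∧ Bunch S μ₂ ν k₂ ∧ μ = μ₁ + μ₂ ∧
        k = k₁ + k₂ + (0, w) := by
  constructor
  · rintro ⟨_, l, _, h, ⟨ν, rfl, rfl⟩, rfl⟩
    obtain ⟨μ₁, μ₂, k₁, k₂, h₁, h₂, rfl, rfl⟩ := bunch_add_iff.1 h
    exact ⟨ν, μ₁, μ₂, k₁, k₂, (bunch_singleton_iff (T := pair R S)).1 h₁,
      bunch_pair_map_inr_iff.1 h₂, rfl, rfl⟩
  · rintro ⟨ν, μ₁, μ₂, k₁, k₂, h₁, h₂, rfl, rfl⟩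
    exact ⟨_, _, _, bunch_add_iff.2 ⟨_, _, _, _, (bunch_singleton_iff (T := pair R S) (a := Sum.inl (ν, b))).2 h₁,
      bunch_pair_map_inr_iff.2 h₂, rfl, rfl⟩, ⟨ν, rfl, rfl⟩, rfl⟩

theorem comp_op_iff {f : ℕ → ℕ} {R : KRel X ℕ} {μ : Multiset X} {m : ℕ} {k : Weight} :
    comp (op f) R μ m k ↔ ∃ j l, R μ j l ∧ m = f j ∧ k = l + (0, 1) := by
  constructor
  · rintro ⟨_, l, _, h, ⟨⟨j, rfl, rfl⟩, rfl⟩, rfl⟩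
    exact ⟨j, l, bunch_singleton_iff.1 h, rfl, rfl⟩
  · rintro ⟨j, l, h, rfl, rfl⟩
    exact ⟨_, l, _, bunch_singleton_iff.2 h, ⟨⟨j, rfl, rfl⟩, rfl⟩, rfl⟩

theorem comp_cond_iff {R : KRel Z ℕ} {S T : KRel Z X} {μ : Multiset Z} {a : X} {k : Weight} :
    comp (cond X) (pair R (pair S T)) μ a k ↔
      ∃ j μ₁ μ₂ k₁ k₂, R μ₁ j k₁ ∧ (if j = 0 then S μ₂ a k₂ else T μ₂ a k₂) ∧ μ = μ₁ + μ₂ ∧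
        k = k₁ + k₂ + (0, 1) := by
  constructor
  · rintro ⟨_, l, _, h, ⟨rfl | ⟨j, rfl⟩, rfl⟩, rfl⟩
    · obtain ⟨μ₁, μ₂, k₁, k₂, h₁, h₂, rfl, rfl⟩ := bunch_pair_iff.1 h
      exact ⟨0, μ₁, μ₂, k₁, k₂, h₁, h₂, rfl, rfl⟩
    · obtain ⟨μ₁, μ₂, k₁, k₂, h₁, h₂, rfl, rfl⟩ := bunch_pair_iff.1 h
      exact ⟨j + 1, μ₁, μ₂, k₁, k₂, h₁, h₂, rfl, rfl⟩
  · rintro ⟨j, μ₁, μ₂, k₁, k₂, h₁, h₂, rfl, rfl⟩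
    cases j with
    | zero => exact ⟨_, _, _, (bunch_pair_iff (T := pair R (pair S T)) (a := Sum.inl 0)
        (b := Sum.inr (Sum.inl a))).2 ⟨_, _, _, _, h₁, h₂, rfl, rfl⟩, ⟨.inl rfl, rfl⟩, rfl⟩
    | succ j => exact ⟨_, _, _, (bunch_pair_iff (T := pair R (pair S T)) (a := Sum.inl (j + 1))
        (b := Sum.inr (Sum.inr a))).2 ⟨_, _, _, _, h₁, h₂, rfl, rfl⟩, ⟨.inr ⟨j, rfl⟩, rfl⟩, rfl⟩

/-! ### The fixpoint equation -/

theorem fixApprox_succ_of_fixApprox {n : ℕ} {μ : Multiset (Multiset X × X)} {a : X} {k : Weight}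
    (h : fixApprox X n μ a k) : fixApprox X (n + 1) μ a k := by
  induction n generalizing μ a k with
  | zero => exact h.elim
  | succ n ih =>
    obtain ⟨ν, μ₁, μ₂, k₁, k₂, h₁, h₂, rfl, rfl⟩ := comp_ev_pair_iff.1 h
    exact comp_ev_pair_iff.2 ⟨ν, μ₁, μ₂, k₁, k₂, h₁, h₂.mono fun _ _ _ => ih, rfl, rfl⟩

theorem fixApprox_mono {m n : ℕ} (hmn : m ≤ n) {μ : Multiset (Multiset X × X)} {a : X}
    {k : Weight} (h : fixApprox X m μ a k) : fixApprox X n μ a k := by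
  induction hmn with
  | refl => exact h
  | step _ ih => exact fixApprox_succ_of_fixApprox ih

/-- Continuity: a finite multiset calls on finitely many approximations, and these increase, so one
of them suffices. -/
theorem exists_bunch_fixApprox {μ : Multiset (Multiset X × X)} {ν : Multiset X} {k : Weight}
    (h : Bunch (fix X) μ ν k) : ∃ n, Bunch (fixApprox X n) μ ν k := by
  induction h with
  | zero => exact ⟨0, .zero⟩
  | cons h _ ih =>
    obtain ⟨m, hm⟩ := h
    obtain ⟨n, hn⟩ := ih
    exact ⟨max m n, .cons (fixApprox_mono (le_max_left _ _) hm)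
      (hn.mono fun _ _ _ => fixApprox_mono (le_max_right _ _))⟩

theorem fix_eq : fix X = comp (ev X X 2) (pair (ofFun _root_.id) (fix X)) := by
  funext μ a k
  rw [eq_iff_iff, comp_ev_pair_iff]
  constructor
  · rintro ⟨_ | n, h⟩
    · exact h.elim
    · obtain ⟨ν, μ₁, μ₂, k₁, k₂, h₁, h₂, rfl, rfl⟩ := comp_ev_pair_iff.1 h
      exact ⟨ν, μ₁, μ₂, k₁, k₂, h₁, h₂.mono fun _ _ _ h => ⟨n, h⟩, rfl, rfl⟩
  · rintro ⟨ν, μ₁, μ₂, k₁, k₂, h₁, h₂, rfl, rfl⟩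
    obtain ⟨n, hn⟩ := exists_bunch_fixApprox h₂
    exact ⟨n + 1, comp_ev_pair_iff.2 ⟨ν, μ₁, μ₂, k₁, k₂, h₁, hn, rfl, rfl⟩⟩

theorem fix_comp (R : KRel Z (Multiset X × X)) :
    comp (fix X) R = comp (ev X X 2) (pair R (comp (fix X) R)) := by
  conv_lhs => rw [fix_eq, comp_assoc, pair_comp, ofFun_comp]
  rfl

/-! ### The least cost -/

/-- The tropical matrix of the least costs. -/
noncomputable def least (R : KRel X Y) : KMat X Y := fun μ a => ⨅ k, ⨅ _ : R μ a k, k.1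

theorem least_le {R : KRel X Y} {μ : Multiset X} {a : Y} {k : Weight} (h : R μ a k) :
    least R μ a ≤ k.1 :=
  iInf₂_le k h

theorem exists_le_of_bunch {T : KRel X Y} {σ : Multiset X} {ν : Multiset Y} {k : Weight}
    (h : Bunch T σ ν k) : ∃ ρ : Multiset (Multiset X × Y), (ρ.map Prod.fst).sum = σ ∧
      ρ.map Prod.snd = ν ∧ (ρ.map fun q => least T q.1 q.2).sum ≤ k.1 := by
  induction h with
  | zero => exact ⟨0, by simp⟩
  | @cons μ _ a _ _ _ hT _ ih =>
    obtain ⟨ρ, rfl, rfl, h⟩ := ih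
    refine ⟨(μ, a) ::ₘ ρ, by simp, by simp, ?_⟩
    rw [Multiset.map_cons, Multiset.sum_cons]
    exact add_le_add (least_le hT) h

/-- With `exists_le_of_bunch`, this says that least costs commute with the lifting to multisets; `ρ`
is the pairing that occurs in `Mat.bang`. -/
theorem least_bunch_le (T : KRel X Y) (ρ : Multiset (Multiset X × Y)) :
    ⨅ k, ⨅ _ : Bunch T (ρ.map Prod.fst).sum (ρ.map Prod.snd) k, k.1 ≤
      (ρ.map fun q => least T q.1 q.2).sum := by
  induction ρ using Multiset.induction_on with
  | empty => exact iInf₂_le (0 : Weight) Bunch.zero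
  | cons q ρ ih =>
    simp only [Multiset.map_cons, Multiset.sum_cons]
    refine le_trans ?_ (add_le_add_right ih _)
    simp only [least, ENNReal.iInf_add, ENNReal.add_iInf, le_iInf_iff]
    intro k hk l hl
    exact iInf₂_le_of_le (f := fun (k : Weight) _ => k.1) (l + k) (.cons hl hk) le_rfl

theorem least_comp (S : KRel Y Z) (T : KRel X Y) :
    least (comp S T) = KMat.comp (least S) (least T) := by
  funext μ c
  apply le_antisymm
  · simp only [KMat.comp, Mat.comp, Mat.bang, Mat.dig]
    refine le_iInf fun ν => ?_
    simp only [ENNReal.add_iInf, ENNReal.iInf_add, le_iInf_iff]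
    rintro m ⟨ρ, rfl, rfl⟩
    -- The comultiplication contributes `0` if the parts add up to `μ`, and `∞` otherwise.
    by_cases hm : (ρ.map Prod.fst).sum = μ
    · subst hm
      simp only [tval, if_true, add_zero]
      refine le_trans ?_ (add_le_add_right (least_bunch_le T ρ) _)
      simp only [least, ENNReal.iInf_add, ENNReal.add_iInf, le_iInf_iff]
      intro k hk l hl
      refine iInf₂_le_of_le (k + l) ⟨_, _, _, hk, hl, rfl⟩ ?_
      rw [Prod.fst_add, add_comm]
    · simp [tval, hm]
  · refine le_iInf₂ fun k hk => ?_
    obtain ⟨ν, k₁, k₂, h₁, h₂, rfl⟩ := hk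
    obtain ⟨ρ, rfl, rfl, h⟩ := exists_le_of_bunch h₁
    refine iInf_le_of_le (ρ.map Prod.snd) ?_
    rw [Prod.fst_add, add_comm k₁.1]
    refine add_le_add (least_le h₂) (iInf_le_of_le (ρ.map Prod.fst) ?_)
    simp only [Mat.dig, tval, if_true, add_zero]
    exact iInf_le_of_le ⟨ρ, rfl, rfl⟩ h

/-- Constants have cost `0`, and the steps charged to them are forgotten. -/
theorem least_of_iff_tval {R : KRel X Y} {μ : Multiset X} {a : Y} {P : Prop} (w : ℕ)
    (h : ∀ k, R μ a k ↔ P ∧ k = (0, w)) : least R μ a = tval P := by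
  by_cases hP : P <;> simp [least, h, tval, hP]

theorem least_ofFun (f : Y → X) : least (ofFun f) = fun μ a => tval (μ = {f a}) := by
  funext μ a
  exact least_of_iff_tval 0 fun _ => Iff.rfl

theorem least_pair (S : KRel Z X) (T : KRel Z Y) :
    least (pair S T) = KMat.pair (least S) (least T) := by
  funext μ a
  cases a <;> rfl

theorem least_curry (T : KRel (X ⊕ Z) Y) : least (curry T) = KMat.curry (least T) := rfl

theorem least_ev (w : ℕ) : least (ev X Y w) = KMat.ev X Y := by
  funext μ b
  exact least_of_iff_tval w fun _ => by simp [ev]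

theorem least_fix : least (fix X) = KMat.fix X := by
  have h (n : ℕ) : least (fixApprox X n) = KMat.fixApprox X n := by
    induction n with
    | zero => funext μ a; simp [least, fixApprox, KMat.fixApprox]
    | succ n ih =>
      rw [fixApprox, least_comp, least_ev, least_pair, ih, least_ofFun]
      rfl
  funext μ a
  simp only [KMat.fix, ← h, least, fix, iInf_exists]
  rw [iInf_comm]

theorem least_num (j : ℕ) : least (num X j) = KMat.num X j := by
  funext μ m
  exact least_of_iff_tval 0 fun _ => Iff.rfl

theorem least_op (f : ℕ → ℕ) : least (op f) = fun μ m => tval (∃ k : ℕ, μ = {k} ∧ m = f k) := by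
  funext μ m
  exact least_of_iff_tval 1 fun _ => Iff.rfl

theorem least_cond : least (cond X) = KMat.cond X := by
  funext μ a
  exact least_of_iff_tval 1 fun _ => Iff.rfl

/-! ### Sets of costs -/

/-- All costs of `R` belong to `S`. -/
def CostsIn (S : AddSubmonoid ℝ≥0∞) (R : KRel X Y) : Prop := ∀ μ a k, R μ a k → k.1 ∈ S

theorem CostsIn.comp {S : AddSubmonoid ℝ≥0∞} {Q : KRel Y Z} {R : KRel X Y} (hQ : CostsIn S Q)
    (hR : CostsIn S R) : CostsIn S (comp Q R) := by
  rintro μ c _ ⟨ν, k₁, k₂, h₁, h₂, rfl⟩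
  refine S.add_mem ?_ (hQ _ _ _ h₂)
  clear h₂
  induction h₁ with
  | zero => exact S.zero_mem
  | cons h _ ih => exact S.add_mem (hR _ _ _ h) ih

theorem CostsIn.pair {S : AddSubmonoid ℝ≥0∞} {Q : KRel Z X} {R : KRel Z Y} (hQ : CostsIn S Q)
    (hR : CostsIn S R) : CostsIn S (pair Q R)
  | _, .inl _, _, h => hQ _ _ _ h
  | _, .inr _, _, h => hR _ _ _ h

theorem costsIn_ofFun (S : AddSubmonoid ℝ≥0∞) (f : Y → X) : CostsIn S (ofFun f) := by
  rintro _ _ _ ⟨_, rfl⟩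
  exact S.zero_mem

theorem costsIn_ev (S : AddSubmonoid ℝ≥0∞) (w : ℕ) : CostsIn S (ev X Y w) := by
  rintro _ _ _ ⟨_, _, rfl⟩
  exact S.zero_mem

theorem costsIn_op (S : AddSubmonoid ℝ≥0∞) (f : ℕ → ℕ) : CostsIn S (op f) := by
  rintro _ _ _ ⟨_, rfl⟩
  exact S.zero_mem

theorem costsIn_cond (S : AddSubmonoid ℝ≥0∞) : CostsIn S (cond X) := by
  rintro _ _ _ ⟨_, rfl⟩
  exact S.zero_mem

theorem costsIn_fix (S : AddSubmonoid ℝ≥0∞) : CostsIn S (fix X) := by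
  rintro μ a k ⟨n, h⟩
  induction n generalizing μ a k with
  | zero => exact h.elim
  | succ n ih => exact (costsIn_ev S 2).comp ((costsIn_ofFun S _).pair ih) _ _ _ h

end KRel

/-! ### Negative logarithms and sums of finitely many costs -/

theorem negLog_one : negLog 1 = 0 := by simp [negLog]

theorem negLog_mul (x y : unitInterval) : negLog (x * y) = negLog x + negLog y := by
  by_cases hx : (x : ℝ) = 0
  · simp [negLog, hx]
  by_cases hy : (y : ℝ) = 0
  · simp [negLog, hy]
  have hx' := Real.log_nonpos x.2.1 x.2.2
  have hy' := Real.log_nonpos y.2.1 y.2.2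
  have hxy : ((x * y : unitInterval) : ℝ) ≠ 0 := mul_ne_zero hx hy
  rw [negLog, negLog, negLog, if_neg hx, if_neg hy, if_neg hxy,
    ← ENNReal.ofReal_add (by linarith) (by linarith), Set.Icc.coe_mul, Real.log_mul hx hy, neg_add]

theorem negLog_le_negLog_iff {x y : unitInterval} : negLog x ≤ negLog y ↔ y ≤ x := by
  by_cases hy : (y : ℝ) = 0
  · simp only [negLog, hy, if_true, le_top, true_iff]
    exact Subtype.coe_le_coe.1 (hy ▸ x.2.1)
  have hy0 : 0 < (y : ℝ) := lt_of_le_of_ne y.2.1 (Ne.symm hy)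
  by_cases hx : (x : ℝ) = 0
  · simp only [negLog, hx, hy, if_true, if_false, top_le_iff, ENNReal.ofReal_ne_top, false_iff,
      not_le]
    exact Subtype.coe_lt_coe.1 (hx ▸ hy0)
  have hx0 : 0 < (x : ℝ) := lt_of_le_of_ne x.2.1 (Ne.symm hx)
  rw [negLog, negLog, if_neg hx, if_neg hy,
    ENNReal.ofReal_le_ofReal_iff (neg_nonneg.2 (Real.log_nonpos y.2.1 y.2.2)), neg_le_neg_iff,
    Real.log_le_log_iff hy0 hx0, Subtype.coe_le_coe]

/-- A nonempty set of sums of elements of a finite set of costs has a least element. -/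
theorem exists_minimum_of_subset_closure {F : Set ℝ≥0∞} (hF : F.Finite) {C : Set ℝ≥0∞}
    (hC : C ⊆ AddSubmonoid.closure F) (hne : C.Nonempty) : ∃ c ∈ C, ∀ c' ∈ C, c ≤ c' := by
  have hwf : (AddSubmonoid.closure F : Set ℝ≥0∞).IsPWO := by
    rw [AddSubmonoid.closure_eq_image_sum]
    -- Higman's lemma for lists over `F`. Summation is monotone for the subword order because
    -- omitted terms are nonnegative.
    refine (hF.isPWO.partiallyWellOrderedOn_sublistForall₂ (· ≤ ·)).image_of_monotone_on ?_
    exact fun _ _ _ _ h => h.sum_le_sum fun _ _ => zero_le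
  have hC' := (hwf.mono hC).isWF
  exact ⟨hC'.min hne, hC'.min_mem hne, fun c' hc' => hC'.min_le hne hc'⟩

/-- The interpretation of a variable with coefficients in sets of weights. -/
def Var.weights {A : Ty} : {Γ : Ctx} → Var Γ A → KRel (ctxWeb Γ) A.web
  | _ :: _, .zero => KRel.ofFun Sum.inl
  | _ :: _, .succ x => KRel.comp x.weights (KRel.ofFun Sum.inr)

theorem Var.least_weights {A : Ty} :
    {Γ : Ctx} → (x : Var Γ A) → KRel.least x.weights = x.interp
  | _ :: _, .zero => KRel.least_ofFun _
  | _ :: _, .succ x => by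
    rw [weights, KRel.least_comp, x.least_weights, KRel.least_ofFun]
    rfl

/-! ### Weights of terms -/

namespace PPCF

variable {ι : Type u}

/-- The interpretation of a term with coefficients in sets of weights. -/
noncomputable def weights (p : ι → unitInterval) :
    {Γ : Ctx} → {A : Ty} → PPCF ι Γ A → KRel (ctxWeb Γ) A.web
  | _, _, .var x => x.weights
  | _, _, .lam M => KRel.curry (weights p M)
  | _, _, .app M N => KRel.comp (KRel.ev _ _ 1) (KRel.pair (weights p M) (weights p N))
  | _, A, .fix M => KRel.comp (KRel.fix A.web) (weights p M)
  | Γ, _, .num k => KRel.num (ctxWeb Γ) k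
  | _, _, .succ M => KRel.comp (KRel.op (· + 1)) (weights p M)
  | _, _, .pred M => KRel.comp (KRel.op (· - 1)) (weights p M)
  | _, A, .ifz P M N =>
      KRel.comp (KRel.cond A.web) (KRel.pair (weights p P) (KRel.pair (weights p M) (weights p N)))
  | _, _, .choice i M N => fun μ a k => ∃ l,
      (weights p M μ a l ∧ k = l + (negLog (p i), 1)) ∨
        (weights p N μ a l ∧ k = l + (negLog (unitInterval.symm (p i)), 1))

/-- The tropical interpretation consists of the least costs. -/
theorem least_weights (p : ι → unitInterval) {Γ : Ctx} {A : Ty} (M : PPCF ι Γ A) :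
    KRel.least (M.weights p) = (M.translate (fun i => negLog (p i))
      (fun i => negLog (unitInterval.symm (p i)))).interp := by
  induction M with
  | var x => exact x.least_weights
  | lam M ih => rw [weights, KRel.least_curry, ih]; rfl
  | app M N ihM ihN => rw [weights, KRel.least_comp, KRel.least_ev, KRel.least_pair, ihM, ihN]; rfl
  | fix M ih => rw [weights, KRel.least_comp, KRel.least_fix, ih]; rfl
  | num k => exact KRel.least_num k
  | succ M ih => rw [weights, KRel.least_comp, KRel.least_op, ih]; rfl
  | pred M ih => rw [weights, KRel.least_comp, KRel.least_op, ih]; rfl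
  | ifz P M N ihP ihM ihN =>
    rw [weights, KRel.least_comp, KRel.least_cond, KRel.least_pair, KRel.least_pair, ihP, ihM, ihN]
    rfl
  | choice i M N ihM ihN =>
    funext μ a
    rw [translate, PCFL.interp, PCFL.interp, PCFL.interp, ← ihM, ← ihN]
    apply le_antisymm
    · refine le_min ?_ ?_ <;> simp only [KRel.least, ENNReal.iInf_add, le_iInf_iff] <;> intro l hl
      · exact iInf₂_le_of_le (f := fun (k : Weight) _ => k.1) _ ⟨l, .inl ⟨hl, rfl⟩⟩ le_rfl
      · exact iInf₂_le_of_le (f := fun (k : Weight) _ => k.1) _ ⟨l, .inr ⟨hl, rfl⟩⟩ le_rfl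
    · refine le_iInf₂ fun k hk => ?_
      obtain ⟨l, ⟨hl, rfl⟩ | ⟨hl, rfl⟩⟩ := hk
      · exact (min_le_left _ _).trans (add_le_add_left (KRel.least_le hl) _)
      · exact (min_le_right _ _).trans (add_le_add_left (KRel.least_le hl) _)

/-! ### Substitution -/

/-- The interpretation of a substitution, for a family of interpretations of the terms. -/
def substWeights {X : Type} :
    {Γ : Ctx} → (∀ A : Ty, Var Γ A → KRel X A.web) → KRel X (ctxWeb Γ)
  | [], _ => fun _ x _ => x.elim
  | _ :: _, s => KRel.pair (s _ .zero) (substWeights fun A x => s A (.succ x))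

theorem substWeights_comp {X Y : Type} {Γ : Ctx} (s : ∀ A : Ty, Var Γ A → KRel X A.web)
    (T : KRel Y X) :
    substWeights (fun A x => KRel.comp (s A x) T) = KRel.comp (substWeights s) T := by
  induction Γ with
  | nil => funext _ x; exact x.elim
  | cons A Γ ih => rw [substWeights, substWeights, KRel.pair_comp, ih]

theorem substWeights_var (Γ : Ctx) :
    substWeights (fun A (x : Var Γ A) => x.weights) = KRel.ofFun _root_.id := by
  induction Γ with
  | nil => funext _ x; exact x.elim
  | cons A Γ ih =>
    have h := substWeights_comp (fun A (x : Var Γ A) => x.weights)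
      (KRel.ofFun (Sum.inr : _ → A.web ⊕ ctxWeb Γ))
    rw [ih, KRel.ofFun_comp] at h
    rw [← KRel.pair_inl_inr, substWeights]
    exact congrArg _ h

theorem Var.weights_comp_substWeights {X : Type} {A : Ty} : {Γ : Ctx} → (x : Var Γ A) →
    (s : ∀ A : Ty, Var Γ A → KRel X A.web) → KRel.comp x.weights (substWeights s) = s A x
  | _ :: _, .zero, _ => KRel.inl_comp_pair _ _
  | _ :: _, .succ x, s => by
    rw [TropicalPCF.Var.weights, KRel.comp_assoc, substWeights, KRel.inr_comp_pair,
      Var.weights_comp_substWeights]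

theorem choice_weights_comp (p : ι → unitInterval) {X : Type} {Γ : Ctx} {A : Ty} (i : ι)
    (M N : PPCF ι Γ A) (T : KRel X (ctxWeb Γ)) :
    KRel.comp ((PPCF.choice i M N).weights p) T = fun μ a k => ∃ l,
      (KRel.comp (M.weights p) T μ a l ∧ k = l + (negLog (p i), 1)) ∨
        (KRel.comp (N.weights p) T μ a l ∧ k = l + (negLog (unitInterval.symm (p i)), 1)) := by
  funext μ a k
  rw [eq_iff_iff]
  constructor
  · rintro ⟨ν, k₁, _, h, ⟨l, ⟨hl, rfl⟩ | ⟨hl, rfl⟩⟩, rfl⟩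
    · exact ⟨k₁ + l, .inl ⟨⟨ν, k₁, l, h, hl, rfl⟩, by abel⟩⟩
    · exact ⟨k₁ + l, .inr ⟨⟨ν, k₁, l, h, hl, rfl⟩, by abel⟩⟩
  · rintro ⟨_, ⟨⟨ν, k₁, l, h, hl, rfl⟩, rfl⟩ | ⟨⟨ν, k₁, l, h, hl, rfl⟩, rfl⟩⟩
    · exact ⟨ν, k₁, _, h, ⟨l, .inl ⟨hl, rfl⟩⟩, by abel⟩
    · exact ⟨ν, k₁, _, h, ⟨l, .inr ⟨hl, rfl⟩⟩, by abel⟩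

/-- Needed before `weights_subst`, since substitution under a binder weakens the substituted terms.
-/
theorem weights_rename (p : ι → unitInterval) {Γ Δ : Ctx} {A : Ty} (M : PPCF ι Γ A)
    (r : ∀ B : Ty, Var Γ B → Var Δ B) :
    (M.rename r).weights p =
      KRel.comp (M.weights p) (substWeights fun B x => (r B x).weights) := by
  induction M generalizing Δ with
  | var x => exact (Var.weights_comp_substWeights x fun B x => (r B x).weights).symm
  | lam M ih =>
    rw [rename, weights, weights, ih, KRel.curry_comp, ← substWeights_comp]
    rfl
  | app M N ihM ihN => rw [rename, weights, weights, KRel.comp_assoc, KRel.pair_comp, ihM, ihN]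
  | fix M ih => rw [rename, weights, weights, KRel.comp_assoc, ih]
  | num k => exact (KRel.num_comp _ k).symm
  | succ M ih => rw [rename, weights, weights, KRel.comp_assoc, ih]
  | pred M ih => rw [rename, weights, weights, KRel.comp_assoc, ih]
  | ifz P M N ihP ihM ihN =>
    rw [rename, weights, weights, KRel.comp_assoc, KRel.pair_comp, KRel.pair_comp, ihP, ihM, ihN]
  | choice i M N ihM ihN => rw [rename, choice_weights_comp, weights, ihM, ihN]

theorem weights_weaken (p : ι → unitInterval) {Γ : Ctx} {A : Ty} (M : PPCF ι Γ A) (B : Ty) :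
    (M.rename fun _ x => (Var.succ x : Var (B :: Γ) _)).weights p =
      KRel.comp (M.weights p) (KRel.ofFun Sum.inr) := by
  rw [weights_rename]
  have h := substWeights_comp (fun A (x : Var Γ A) => x.weights)
    (KRel.ofFun (Sum.inr : _ → B.web ⊕ ctxWeb Γ))
  rw [substWeights_var, KRel.ofFun_comp] at h
  exact congrArg _ h

theorem weights_subst (p : ι → unitInterval) {Γ Δ : Ctx} {A : Ty} (M : PPCF ι Γ A)
    (s : ∀ B : Ty, Var Γ B → PPCF ι Δ B) :
    (M.subst s).weights p =
      KRel.comp (M.weights p) (substWeights fun B x => (s B x).weights p) := by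
  induction M generalizing Δ with
  | var x => exact (Var.weights_comp_substWeights x fun B x => (s B x).weights p).symm
  | lam M ih =>
    rw [subst, weights, weights, ih, KRel.curry_comp, ← substWeights_comp]
    -- Composing with the second projection is weakening, which exhibits the lifted substitution.
    simp only [← weights_weaken]
    rfl
  | app M N ihM ihN => rw [subst, weights, weights, KRel.comp_assoc, KRel.pair_comp, ihM, ihN]
  | fix M ih => rw [subst, weights, weights, KRel.comp_assoc, ih]
  | num k => exact (KRel.num_comp _ k).symm
  | succ M ih => rw [subst, weights, weights, KRel.comp_assoc, ih]
  | pred M ih => rw [subst, weights, weights, KRel.comp_assoc, ih]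
  | ifz P M N ihP ihM ihN =>
    rw [subst, weights, weights, KRel.comp_assoc, KRel.pair_comp, KRel.pair_comp, ihP, ihM, ihN]
  | choice i M N ihM ihN => rw [subst, choice_weights_comp, weights, ihM, ihN]

theorem weights_inst (p : ι → unitInterval) {Γ : Ctx} {A B : Ty} (M : PPCF ι (B :: Γ) A)
    (N : PPCF ι Γ B) : (M.inst N).weights p =
      KRel.comp (M.weights p) (KRel.pair (N.weights p) (KRel.ofFun _root_.id)) := by
  rw [inst, weights_subst, ← substWeights_var]
  rfl

/-! ### Reduction -/

theorem weights_beta_iff (p : ι → unitInterval) {Γ : Ctx} {A B : Ty} (M : PPCF ι (B :: Γ) A)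
    (N : PPCF ι Γ B) {μ : Multiset (ctxWeb Γ)} {a : A.web} {k : Weight} :
    (PPCF.app (.lam M) N).weights p μ a k ↔ ∃ l, (M.inst N).weights p μ a l ∧ k = l + (0, 1) := by
  simp only [weights_inst, weights, KRel.comp_ev_pair_iff]
  constructor
  · rintro ⟨ν, μ₁, μ₂, k₁, k₂, h₁, h₂, rfl, rfl⟩
    refine ⟨_, ⟨_, k₂, k₁, KRel.bunch_add_iff.2 ⟨μ₂, μ₁, k₂, 0, KRel.bunch_pair_map_inl_iff.2 h₂,
      KRel.bunch_pair_map_inr_iff.2 (KRel.bunch_ofFun_iff.2 ⟨?_, rfl⟩), add_comm _ _, ?_⟩,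
      h₁, rfl⟩, ?_⟩
    · simp
    · simp
    · abel
  · rintro ⟨_, ⟨θ, k₂, k₁, h₂, h₁, rfl⟩, rfl⟩
    -- Split the demands on the body into those on the bound variable, met by `N`, and those on the
    -- context.
    obtain ⟨ν, τ, rfl⟩ : ∃ (ν : Multiset B.web) (τ : Multiset (ctxWeb Γ)),
        θ = ν.map Sum.inl + τ.map Sum.inr := by
      clear h₁ h₂
      induction θ using Multiset.induction_on with
      | empty => exact ⟨0, 0, by simp⟩
      | cons x θ ih =>
        obtain ⟨ν, τ, rfl⟩ := ih
        cases x with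
        | inl x => exact ⟨x ::ₘ ν, τ, by simp⟩
        | inr x => exact ⟨ν, x ::ₘ τ, by simp⟩
    obtain ⟨μ₂, μ₁, l₂, l₁, h₃, h₄, rfl, rfl⟩ := KRel.bunch_add_iff.1 h₂
    obtain ⟨rfl, rfl⟩ := KRel.bunch_ofFun_iff.1 (KRel.bunch_pair_map_inr_iff.1 h₄)
    refine ⟨ν, τ, μ₂, k₁, l₂, h₁, KRel.bunch_pair_map_inl_iff.1 h₃, ?_, by abel⟩
    simp [add_comm]

theorem weights_fix_iff (p : ι → unitInterval) {Γ : Ctx} {A : Ty} (M : PPCF ι Γ (Ty.arr A A))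
    {μ : Multiset (ctxWeb Γ)} {a : A.web} {k : Weight} :
    (PPCF.fix M).weights p μ a k ↔
      ∃ l, (PPCF.app M (.fix M)).weights p μ a l ∧ k = l + (0, 1) := by
  have e : (PPCF.fix M).weights p μ a k ↔ KRel.comp (KRel.ev A.web A.web 2)
      (KRel.pair (M.weights p) ((PPCF.fix M).weights p)) μ a k :=
    (congrFun (congrFun (congrFun (KRel.fix_comp (M.weights p)) μ) a) k).to_iff
  -- One step for the unfolding, one for the application it creates.
  have two (k : Weight) : k + (0, 2) = k + (0, 1) + (0, 1) := by simp [add_assoc]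
  rw [e, KRel.comp_ev_pair_iff]
  constructor
  · rintro ⟨ν, μ₁, μ₂, k₁, k₂, h₁, h₂, rfl, rfl⟩
    exact ⟨_, KRel.comp_ev_pair_iff.2 ⟨ν, μ₁, μ₂, k₁, k₂, h₁, h₂, rfl, rfl⟩, two _⟩
  · rintro ⟨_, h, rfl⟩
    obtain ⟨ν, μ₁, μ₂, k₁, k₂, h₁, h₂, rfl, rfl⟩ := KRel.comp_ev_pair_iff.1 h
    exact ⟨ν, μ₁, μ₂, k₁, k₂, h₁, h₂, rfl, (two _).symm⟩

/-- Subject expansion. -/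
theorem Step.weights_of_weights (p : ι → unitInterval) {Γ : Ctx} {A : Ty} {M M' : PPCF ι Γ A}
    (h : Step M M') {μ : Multiset (ctxWeb Γ)} {a : A.web} {k : Weight}
    (hM' : M'.weights p μ a k) : M.weights p μ a (k + (negLog (h.prob p), 1)) := by
  induction h generalizing μ k with
  | beta M N =>
    rw [Step.prob, negLog_one]
    exact (weights_beta_iff p M N).2 ⟨k, hM', rfl⟩
  | unfold M =>
    rw [Step.prob, negLog_one]
    exact (weights_fix_iff p M).2 ⟨k, hM', rfl⟩
  | succNum j =>
    rw [Step.prob, negLog_one]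
    obtain ⟨⟨rfl, rfl⟩, rfl⟩ := hM'
    exact KRel.comp_op_iff.2 ⟨j, 0, ⟨⟨rfl, rfl⟩, rfl⟩, rfl, rfl⟩
  | predZero =>
    rw [Step.prob, negLog_one]
    obtain ⟨⟨rfl, rfl⟩, rfl⟩ := hM'
    exact KRel.comp_op_iff.2 ⟨0, 0, ⟨⟨rfl, rfl⟩, rfl⟩, rfl, rfl⟩
  | predSucc j =>
    rw [Step.prob, negLog_one]
    obtain ⟨⟨rfl, hm⟩, rfl⟩ := hM'
    exact KRel.comp_op_iff.2 ⟨j + 1, 0, ⟨⟨rfl, rfl⟩, rfl⟩, hm, rfl⟩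
  | ifzZero M N =>
    rw [Step.prob, negLog_one]
    exact KRel.comp_cond_iff.2 ⟨0, 0, μ, 0, k, ⟨⟨rfl, rfl⟩, rfl⟩, hM', by simp, by simp⟩
  | ifzSucc j M N =>
    rw [Step.prob, negLog_one]
    exact KRel.comp_cond_iff.2 ⟨j + 1, 0, μ, 0, k, ⟨⟨rfl, rfl⟩, rfl⟩, hM', by simp, by simp⟩
  | choiceLeft i M N => exact ⟨k, .inl ⟨hM', rfl⟩⟩
  | choiceRight i M N => exact ⟨k, .inr ⟨hM', rfl⟩⟩
  | appCtx N h ih =>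
    obtain ⟨ν, μ₁, μ₂, k₁, k₂, h₁, h₂, rfl, rfl⟩ := KRel.comp_ev_pair_iff.1 hM'
    exact KRel.comp_ev_pair_iff.2 ⟨ν, μ₁, μ₂, _, k₂, ih h₁, h₂, rfl, by rw [Step.prob]; abel⟩
  | succCtx h ih =>
    obtain ⟨j, l, hl, rfl, rfl⟩ := KRel.comp_op_iff.1 hM'
    exact KRel.comp_op_iff.2 ⟨j, _, ih hl, rfl, by rw [Step.prob]; abel⟩
  | predCtx h ih =>
    obtain ⟨j, l, hl, rfl, rfl⟩ := KRel.comp_op_iff.1 hM'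
    exact KRel.comp_op_iff.2 ⟨j, _, ih hl, rfl, by rw [Step.prob]; abel⟩
  | ifzCtx M N h ih =>
    obtain ⟨j, μ₁, μ₂, k₁, k₂, h₁, h₂, rfl, rfl⟩ := KRel.comp_cond_iff.1 hM'
    exact KRel.comp_cond_iff.2 ⟨j, μ₁, μ₂, _, k₂, ih h₁, h₂, rfl, by rw [Step.prob]; abel⟩

/-- Abstractions and numerals. -/
def IsValue {Γ : Ctx} {A : Ty} : PPCF ι Γ A → Prop
  | .lam _ => True
  | .num _ => True
  | _ => False

/-- Progress and weighted subject reduction for closed terms. -/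
theorem isValue_or_exists_step (p : ι → unitInterval) : {A : Ty} → (M : PPCF ι [] A) →
    {μ : Multiset (ctxWeb [])} → {a : A.web} → {k : Weight} → M.weights p μ a k →
    M.IsValue ∨ ∃ (M' : PPCF ι [] A) (h : Step M M') (l : Weight),
      M'.weights p μ a l ∧ k = l + (negLog (h.prob p), 1)
  | _, .lam _, _, _, _, _ => .inl trivial
  | _, .num _, _, _, _, _ => .inl trivial
  | _, .fix M, _, _, _, hM => by
    obtain ⟨l, hl, rfl⟩ := (weights_fix_iff p M).1 hM
    exact .inr ⟨_, .unfold M, l, hl, by rw [Step.prob, negLog_one]⟩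
  | _, .choice i M N, _, _, _, hM => by
    obtain ⟨l, ⟨hl, rfl⟩ | ⟨hl, rfl⟩⟩ := hM
    · exact .inr ⟨_, .choiceLeft i M N, l, hl, rfl⟩
    · exact .inr ⟨_, .choiceRight i M N, l, hl, rfl⟩
  | _, .app M N, _, _, _, hM => by
    obtain ⟨ν, μ₁, μ₂, k₁, k₂, h₁, h₂, rfl, rfl⟩ := KRel.comp_ev_pair_iff.1 hM
    rcases isValue_or_exists_step p M h₁ with hv | ⟨M', h, l, hl, rfl⟩
    · cases M with
      | lam M =>
        -- The weight of the whole redex is used here, not its decomposition into `h₁` and `h₂`.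
        obtain ⟨l, hl, e⟩ := (weights_beta_iff p M N).1 hM
        exact .inr ⟨_, .beta M N, l, hl, by rw [e, Step.prob, negLog_one]⟩
      | _ => exact hv.elim
    · exact .inr ⟨_, .appCtx N h, _,
        KRel.comp_ev_pair_iff.2 ⟨ν, μ₁, μ₂, l, k₂, hl, h₂, rfl, rfl⟩, by rw [Step.prob]; abel⟩
  | _, .succ M, _, _, _, hM => by
    obtain ⟨j, l, hl, rfl, rfl⟩ := KRel.comp_op_iff.1 hM
    rcases isValue_or_exists_step p M hl with hv | ⟨M', h, l', hl', rfl⟩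
    · cases M with
      | num m =>
        obtain ⟨⟨rfl, rfl⟩, rfl⟩ := hl
        exact .inr ⟨_, .succNum j, 0, ⟨⟨rfl, rfl⟩, rfl⟩, by rw [Step.prob, negLog_one]⟩
      | _ => exact hv.elim
    · exact .inr ⟨_, .succCtx h, _, KRel.comp_op_iff.2 ⟨j, l', hl', rfl, rfl⟩,
        by rw [Step.prob]; abel⟩
  | _, .pred M, _, _, _, hM => by
    obtain ⟨j, l, hl, rfl, rfl⟩ := KRel.comp_op_iff.1 hM
    rcases isValue_or_exists_step p M hl with hv | ⟨M', h, l', hl', rfl⟩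
    · cases M with
      | num m =>
        obtain ⟨⟨rfl, rfl⟩, rfl⟩ := hl
        cases j with
        | zero => exact .inr ⟨_, .predZero, 0, ⟨⟨rfl, rfl⟩, rfl⟩, by rw [Step.prob, negLog_one]⟩
        | succ j =>
          exact .inr ⟨_, .predSucc j, 0, ⟨⟨rfl, rfl⟩, rfl⟩, by rw [Step.prob, negLog_one]⟩
      | _ => exact hv.elim
    · exact .inr ⟨_, .predCtx h, _, KRel.comp_op_iff.2 ⟨j, l', hl', rfl, rfl⟩,
        by rw [Step.prob]; abel⟩
  | _, .ifz P M N, _, _, _, hM => by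
    obtain ⟨j, μ₁, μ₂, k₁, k₂, h₁, h₂, rfl, rfl⟩ := KRel.comp_cond_iff.1 hM
    rcases isValue_or_exists_step p P h₁ with hv | ⟨P', h, l, hl, rfl⟩
    · cases P with
      | num m =>
        obtain ⟨⟨rfl, rfl⟩, rfl⟩ := h₁
        cases j with
        | zero => exact .inr ⟨_, .ifzZero M N, k₂, by rw [zero_add]; exact h₂,
            by rw [Step.prob, negLog_one, zero_add]⟩
        | succ j => exact .inr ⟨_, .ifzSucc j M N, k₂, by rw [zero_add]; exact h₂,
            by rw [Step.prob, negLog_one, zero_add]⟩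
      | _ => exact hv.elim
    · exact .inr ⟨_, .ifzCtx M N h, _,
        KRel.comp_cond_iff.2 ⟨j, μ₁, μ₂, l, k₂, hl, h₂, rfl, rfl⟩, by rw [Step.prob]; abel⟩

/-- Each step found by `isValue_or_exists_step` lowers the step count by one, so the search ends at
a value, which must be the numeral `n`. -/
theorem exists_path_of_weights (p : ι → unitInterval) {M : PPCF ι [] Ty.nat} {n : ℕ} {k : Weight}
    (h : M.weights p 0 n k) : ∃ ω : Path M (.num n), negLog (ω.prob p) = k.1 := by
  obtain ⟨c, w⟩ := k
  induction w generalizing M c with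
  | zero =>
    rcases isValue_or_exists_step p M h with hv | ⟨M', h, l, hl, e⟩
    · cases M with
      | num m =>
        obtain ⟨⟨-, rfl⟩, e⟩ := h
        exact ⟨.nil _, by rw [e, Path.prob, negLog_one]; rfl⟩
      | _ => exact hv.elim
    -- A further step would make the step count positive.
    · have := congrArg Prod.snd e
      simp at this
  | succ w ih =>
    rcases isValue_or_exists_step p M h with hv | ⟨M', hs, ⟨d, w'⟩, hl, e⟩
    · cases M with
      | num m =>
        obtain ⟨⟨-, rfl⟩, e⟩ := h
        exact ⟨.nil _, by rw [e, Path.prob, negLog_one]; rfl⟩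
      | _ => exact hv.elim
    · simp only [Prod.mk_add_mk, Prod.mk.injEq, Nat.add_right_cancel_iff] at e
      obtain ⟨rfl, rfl⟩ := e
      obtain ⟨ω, hω⟩ := ih _ hl
      exact ⟨.cons hs ω, by rw [Path.prob, negLog_mul, hω, add_comm]⟩

theorem Path.exists_weights (p : ι → unitInterval) {M : PPCF ι [] Ty.nat} {n : ℕ}
    (ω : Path M (.num n)) : ∃ w, M.weights p 0 n (negLog (ω.prob p), w) := by
  generalize hN : PPCF.num n = N at ω
  induction ω with
  | nil M =>
    subst hN
    exact ⟨0, ⟨rfl, rfl⟩, by rw [Path.prob, negLog_one]; rfl⟩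
  | cons h ω ih =>
    obtain ⟨w, hw⟩ := ih hN
    refine ⟨w + 1, ?_⟩
    rw [Path.prob, negLog_mul, add_comm]
    exact h.weights_of_weights p hw

theorem component_translate_eq_iInf (p : ι → unitInterval) (M : PPCF ι [] Ty.nat) (n : ℕ) :
    (M.translate (fun i => negLog (p i)) (fun i => negLog (unitInterval.symm (p i)))).component n =
      ⨅ ω : Path M (.num n), negLog (ω.prob p) := by
  rw [PCFL.component, ← least_weights]
  apply le_antisymm
  · refine le_iInf fun ω => ?_
    obtain ⟨w, hw⟩ := ω.exists_weights p
    exact KRel.least_le hw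
  · refine le_iInf₂ fun k hk => ?_
    obtain ⟨ω, hω⟩ := exists_path_of_weights p hk
    exact hω ▸ iInf_le _ ω

/-! ### Attainment -/

/-- `F` collects the two costs of each coin in `M`, and is finite even for infinitely many
parameters. Quantifying over all `S` containing `F` lets the sets of the subterms be united
directly. -/
theorem exists_finite_costsIn (p : ι → unitInterval) {Γ : Ctx} {A : Ty} (M : PPCF ι Γ A) :
    ∃ F : Set ℝ≥0∞, F.Finite ∧
      ∀ S : AddSubmonoid ℝ≥0∞, F ⊆ S → KRel.CostsIn S (M.weights p) := by
  induction M with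
  | var x =>
    refine ⟨∅, Set.finite_empty, fun S _ => ?_⟩
    rw [weights]
    induction x with
    | zero => exact KRel.costsIn_ofFun S _
    | succ x ih => exact ih.comp (KRel.costsIn_ofFun S _)
  | lam M ih =>
    obtain ⟨F, hF, h⟩ := ih
    exact ⟨F, hF, fun S hS _ _ => h S hS _ _⟩
  | app M N ihM ihN =>
    obtain ⟨F, hF, h⟩ := ihM
    obtain ⟨G, hG, h'⟩ := ihN
    refine ⟨F ∪ G, hF.union hG, fun S hS => ?_⟩
    rw [Set.union_subset_iff] at hS
    exact (KRel.costsIn_ev S 1).comp ((h S hS.1).pair (h' S hS.2))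
  | fix M ih =>
    obtain ⟨F, hF, h⟩ := ih
    exact ⟨F, hF, fun S hS => (KRel.costsIn_fix S).comp (h S hS)⟩
  | num k =>
    refine ⟨∅, Set.finite_empty, fun S _ => ?_⟩
    rintro _ _ _ ⟨_, rfl⟩
    exact S.zero_mem
  | succ M ih =>
    obtain ⟨F, hF, h⟩ := ih
    exact ⟨F, hF, fun S hS => (KRel.costsIn_op S _).comp (h S hS)⟩
  | pred M ih =>
    obtain ⟨F, hF, h⟩ := ih
    exact ⟨F, hF, fun S hS => (KRel.costsIn_op S _).comp (h S hS)⟩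
  | ifz P M N ihP ihM ihN =>
    obtain ⟨E, hE, h''⟩ := ihP
    obtain ⟨F, hF, h⟩ := ihM
    obtain ⟨G, hG, h'⟩ := ihN
    refine ⟨E ∪ (F ∪ G), hE.union (hF.union hG), fun S hS => ?_⟩
    rw [Set.union_subset_iff, Set.union_subset_iff] at hS
    exact (KRel.costsIn_cond S).comp ((h'' S hS.1).pair ((h S hS.2.1).pair (h' S hS.2.2)))
  | choice i M N ihM ihN =>
    obtain ⟨F, hF, h⟩ := ihM
    obtain ⟨G, hG, h'⟩ := ihN
    refine ⟨{negLog (p i), negLog (unitInterval.symm (p i))} ∪ (F ∪ G),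
      (Set.toFinite _).union (hF.union hG), fun S hS => ?_⟩
    rw [Set.union_subset_iff, Set.union_subset_iff, Set.insert_subset_iff,
      Set.singleton_subset_iff] at hS
    rintro μ a _ ⟨l, ⟨hl, rfl⟩ | ⟨hl, rfl⟩⟩
    · exact S.add_mem (h S hS.2.1 _ _ _ hl) hS.1.1
    · exact S.add_mem (h' S hS.2.2 _ _ _ hl) hS.1.2

theorem exists_isMostLikely (p : ι → unitInterval) {M : PPCF ι [] Ty.nat} {n : ℕ}
    (hne : Nonempty (Path M (.num n))) : ∃ ω : Path M (.num n), ω.IsMostLikely p := by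
  obtain ⟨F, hF, h⟩ := exists_finite_costsIn p M
  have hC : Set.range (fun ω : Path M (.num n) => negLog (ω.prob p)) ⊆ AddSubmonoid.closure F := by
    rintro _ ⟨ω, rfl⟩
    obtain ⟨w, hw⟩ := ω.exists_weights p
    exact h _ AddSubmonoid.subset_closure _ _ _ hw
  obtain ⟨_, ⟨ω, rfl⟩, hω⟩ :=
    exists_minimum_of_subset_closure hF hC (Set.range_nonempty _)
  exact ⟨ω, fun ω' => negLog_le_negLog_iff.1 (hω _ ⟨ω', rfl⟩)⟩

end PPCF

end TropicalPCF

theorem mainTheorem9 {ι : Type*} (M : PPCF ι [] Ty.nat) (n : ℕ) (p : ι → unitInterval) :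
    (M.translate (fun i => negLog (p i)) (fun i => negLog (unitInterval.symm (p i)))).component n
        = (⨅ ω : PPCF.Path M (PPCF.num n), negLog (ω.prob p)) ∧
    (Nonempty (PPCF.Path M (PPCF.num n)) →
      ∃ ω : PPCF.Path M (PPCF.num n), ω.IsMostLikely p) ∧
    ∀ ω : PPCF.Path M (PPCF.num n), ω.IsMostLikely p →
      (M.translate (fun i => negLog (p i)) (fun i => negLog (unitInterval.symm (p i)))).component n
        = negLog (ω.prob p) := by
  refine ⟨PPCF.component_translate_eq_iInf p M n, PPCF.exists_isMostLikely p, fun ω hω => ?_⟩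
  rw [PPCF.component_translate_eq_iInf]
  exact le_antisymm (iInf_le _ ω) (le_iInf fun ω' => negLog_le_negLog_iff.2 (hω ω'))
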